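/- Let $p$ be a prime number. Say that $p$ is represented by $x^2+ny^2$ if there are integers $x,y$ with $p=x^2+ny^2$. (a) If $p\equiv 1\pmod{20}$, then $p$ is represented by both or by neither of the forms $x^2+20y^2$ and $x^2+100y^2$. (b) If $p\equiv 9\pmod{20}$, then $p$ is represented by exactly one of the forms $x^2+20y^2$ and $x^2+100y^2$. -/

import Mathlib

open scoped NumberTheorySymbols

section

variable {p : ℕ} [Fact p.Prime]

/-! Both representability questions are read off from one sign: χ(√5), with χ the quadratic
character mod `p`. Put ε = 1 if p ≡ 1 mod 5 and ε = -1 if p ≡ 4 mod 5. For x² + 100y²: write p = a²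
+ b² with `b` odd. Splitting of `p` in ℚ(ζ₅) gives χ(√5)χ(2(1 + √5)) = ε, and reciprocity turns the
second factor into J(b + 2a | 5). Hence χ(√5) = 1 if 5 ∣ a and -1 if 5 ∣ b. For x² + 20y²: Thue's
lemma gives p = x² + 5y², and reciprocity gives χ(√5) = ±J(x | 5) = ±ε, with sign + exactly when `y`
is even. So the two criteria are χ(√5) = 1 and χ(√5) = ε: equivalent when ε = 1, complementary when
ε = -1. -/

theorem quadraticChar_natCast_eq_jacobiSym (n : ℕ) :
    quadraticChar (ZMod p) (n : ZMod p) = J(n | p) := by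
  rw [← jacobiSym.legendreSym.to_jacobiSym, legendreSym, Int.cast_natCast]

theorem quadraticChar_natCast_eq_jacobiSym_of_odd (hp : p % 4 = 1) {n : ℕ} (hn : Odd n) :
    quadraticChar (ZMod p) (n : ZMod p) = J(p | n) := by
  rw [quadraticChar_natCast_eq_jacobiSym, jacobiSym.quadratic_reciprocity_one_mod_four' hn hp]

theorem jacobiSym_mul_sq {d u : ℤ} {n : ℕ} (h : IsCoprime u n) : J(d * u ^ 2 | n) = J(d | n) := by
  rw [jacobiSym.mul_left, jacobiSym.sq_one' (Int.isCoprime_iff_gcd_eq_one.mp h), mul_one]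

theorem quadraticChar_two_mod_eight_eq_one (hp : p % 8 = 1) :
    quadraticChar (ZMod p) 2 = 1 := by
  have h2 : p ≠ 2 := by rintro rfl; omega
  have h := legendreSym.at_two h2
  rw [legendreSym, Int.cast_ofNat] at h
  rw [h, ZMod.χ₈_nat_mod_eight, hp]; rfl

theorem quadraticChar_two_mod_eight_eq_five (hp : p % 8 = 5) :
    quadraticChar (ZMod p) 2 = -1 := by
  have h2 : p ≠ 2 := by rintro rfl; omega
  have h := legendreSym.at_two h2
  rw [legendreSym, Int.cast_ofNat] at h
  rw [h, ZMod.χ₈_nat_mod_eight, hp]; rfl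

theorem quadraticChar_eq_of_mul_eq_sq {F : Type*} [Field F] [Fintype F] [DecidableEq F]
    {u v w : F} (hu : u ≠ 0) (hv : v ≠ 0) (h : w ^ 2 = u * v) :
    quadraticChar F u = quadraticChar F v := by
  have hw : w ≠ 0 := by
    rintro rfl
    exact mul_ne_zero hu hv (by rw [← h]; ring)
  have h1 := quadraticChar_sq_one' hw
  rw [h, map_mul] at h1
  have h2 := quadraticChar_sq_one hv
  calc quadraticChar F u = quadraticChar F u * quadraticChar F v ^ 2 := by rw [h2, mul_one]
    _ = _ := by rw [pow_two, ← mul_assoc, h1, one_mul]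

theorem quadraticChar_neg_one_of_mod_four (hp : p % 4 = 1) :
    quadraticChar (ZMod p) (-1) = 1 := by
  rw [quadraticChar_one_iff_isSquare (by simp), ZMod.exists_sq_eq_neg_one_iff]
  omega

theorem natCast_ne_zero_of_prime {n : ℕ} (hn : Nat.Prime n)
    (h : n ≠ p) : (n : ZMod p) ≠ 0 := by
  rw [Ne, ZMod.natCast_eq_zero_iff]
  exact fun hd => h ((Nat.prime_dvd_prime_iff_eq Fact.out hn).mp hd).symm

theorem two_ne_zero_of_mod_four (hp : p % 4 = 1) : (2 : ZMod p) ≠ 0 := by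
  have := natCast_ne_zero_of_prime (p := p) Nat.prime_two (by omega)
  exact_mod_cast this

theorem five_ne_zero_of_mod_five (hp : p % 5 ≠ 0) : (5 : ZMod p) ≠ 0 := by
  have : ((5 : ℕ) : ZMod p) ≠ 0 := by
    rw [Ne, ZMod.natCast_eq_zero_iff]
    intro hd
    have := (Nat.prime_dvd_prime_iff_eq Fact.out Nat.prime_five).mp hd
    omega
  exact_mod_cast this

/-- A square root of `-1` has the same quadratic character as `2`, since `(1 + i)² = 2 * i`. -/
theorem quadraticChar_sqrt_neg_one (hp : p % 4 = 1) {i : ZMod p} (hi : i ^ 2 = -1) :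
    quadraticChar (ZMod p) i = quadraticChar (ZMod p) 2 := by
  have h0 : i ≠ 0 := by rintro rfl; simp at hi
  exact quadraticChar_eq_of_mul_eq_sq (w := 1 + i) h0 (two_ne_zero_of_mod_four hp)
    (by linear_combination hi)

/-- In a relation `x² + 5 * y² = 0`, the quadratic character of `√5` is read off from `x`, `y`. -/
theorem quadraticChar_sqrt_five_mul (hp : p % 4 = 1) {c x y : ZMod p}
    (hc : c ^ 2 = 5) (h : x ^ 2 + 5 * y ^ 2 = 0) :
    quadraticChar (ZMod p) x =
      quadraticChar (ZMod p) 2 * quadraticChar (ZMod p) c * quadraticChar (ZMod p) y := by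
  obtain ⟨i, hi⟩ : IsSquare (-1 : ZMod p) := ZMod.exists_sq_eq_neg_one_iff.mpr (by omega)
  have hi2 : i ^ 2 = -1 := by rw [pow_two, ← hi]
  have h1 : x ^ 2 = (i * c * y) ^ 2 := by
    linear_combination h - c ^ 2 * y ^ 2 * hi2 + y ^ 2 * hc
  rw [← quadraticChar_sqrt_neg_one hp hi2, ← map_mul, ← map_mul]
  rcases sq_eq_sq_iff_eq_or_eq_neg.mp h1 with h2 | h2
  · rw [h2]
  · rw [h2, neg_eq_neg_one_mul, map_mul, quadraticChar_neg_one_of_mod_four hp, one_mul]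

theorem jacobiSym_five_of_sq_mod_one {n : ℤ} (h : n ^ 2 % 5 = 1) : J(n | 5) = 1 := by
  rw [jacobiSym.mod_left]
  have : n % 5 = 0 ∨ n % 5 = 1 ∨ n % 5 = 2 ∨ n % 5 = 3 ∨ n % 5 = 4 := by omega
  rcases this with h1 | h1 | h1 | h1 | h1 <;> simp [pow_two, Int.mul_emod, h1] at h ⊢
  all_goals decide +kernel

theorem jacobiSym_five_of_sq_mod_four {n : ℤ} (h : n ^ 2 % 5 = 4) : J(n | 5) = -1 := by
  rw [jacobiSym.mod_left]
  have : n % 5 = 0 ∨ n % 5 = 1 ∨ n % 5 = 2 ∨ n % 5 = 3 ∨ n % 5 = 4 := by omega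
  rcases this with h1 | h1 | h1 | h1 | h1 <;> simp [pow_two, Int.mul_emod, h1] at h ⊢
  all_goals decide +kernel

/-! ### Characters of the coordinates of a representation -/

theorem coprime_of_prime_eq_sq_add_mul_sq {x y d : ℕ} (h : p = x ^ 2 + d * y ^ 2) :
    Nat.Coprime x y := by
  have hp : p.Prime := Fact.out
  rw [Nat.coprime_iff_gcd_eq_one]
  have h1 : Nat.gcd x y ^ 2 ∣ p := by
    rw [h]
    exact dvd_add (pow_dvd_pow_of_dvd (Nat.gcd_dvd_left x y) 2)
      ((pow_dvd_pow_of_dvd (Nat.gcd_dvd_right x y) 2).mul_left d)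
  have h2 : Nat.gcd x y * Nat.gcd x y ∣ p := by rwa [← pow_two]
  exact Nat.isUnit_iff.mp ((Nat.prime_iff.mp hp).irreducible.squarefree _ h2)

theorem ne_zero_of_prime_eq_sq_add {x k : ℕ} (h : p = x ^ 2 + k) (hk : k = 0) : False := by
  subst hk
  have hp : p.Prime := Fact.out
  rw [h, add_zero] at hp
  exact (Nat.Prime.prime hp).not_isSquare ⟨x, by ring⟩

/-- Modulo `y`, `p` is the square x²; reciprocity transfers this to χ(y). -/
theorem quadraticChar_odd_of_eq_sq_add_mul_sq (hp : p % 4 = 1) {x y d : ℕ}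
    (h : p = x ^ 2 + d * y ^ 2) (hy : Odd y) : quadraticChar (ZMod p) (y : ZMod p) = 1 := by
  have hxy := coprime_of_prime_eq_sq_add_mul_sq h
  rw [quadraticChar_natCast_eq_jacobiSym_of_odd hp hy]
  have : J((p : ℤ) | y) = J(1 * (x : ℤ) ^ 2 | y) := by
    apply jacobiSym.mod_left'
    rw [h]; push_cast
    have : (x : ℤ) ^ 2 + d * y ^ 2 = 1 * (x : ℤ) ^ 2 + y * (d * y) := by ring
    rw [this, Int.add_mul_emod_self_left]
  rw [this, jacobiSym_mul_sq (Nat.isCoprime_iff_coprime.mpr hxy), jacobiSym.one_left]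

/-- Modulo `n`, p ≡ 5y²; apply reciprocity twice, for `p` and then for 5. -/
theorem quadraticChar_odd_of_dvd (hp : p % 4 = 1) {x y n : ℕ}
    (h : p = x ^ 2 + 5 * y ^ 2) (hn : Odd n) (hnx : n ∣ x) :
    quadraticChar (ZMod p) (n : ZMod p) = J(n | 5) := by
  have hxy := (coprime_of_prime_eq_sq_add_mul_sq h).coprime_dvd_left hnx
  obtain ⟨k, rfl⟩ := hnx
  rw [quadraticChar_natCast_eq_jacobiSym_of_odd hp hn]
  have : J((p : ℤ) | n) = J(5 * (y : ℤ) ^ 2 | n) := by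
    apply jacobiSym.mod_left'
    rw [h]; push_cast
    have : ((n : ℤ) * k) ^ 2 + 5 * y ^ 2 = 5 * (y : ℤ) ^ 2 + n * (k * (n * k)) := by ring
    rw [this, Int.add_mul_emod_self_left]
  rw [this, jacobiSym_mul_sq (Nat.isCoprime_iff_coprime.mpr hxy.symm)]
  exact jacobiSym.quadratic_reciprocity_one_mod_four (a := 5) (by norm_num) hn

/-- The odd part of `y` has character 1, so χ(y) = χ(2): either 2 divides `y` exactly once, or 4 ∣
y, which forces p ≡ 1 mod 8 and χ(2) = 1. -/
theorem quadraticChar_sqrt_five_of_even_right (hp : p % 4 = 1) {c : ZMod p} (hc : c ^ 2 = 5)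
    {x y : ℕ} (h : p = x ^ 2 + 5 * y ^ 2) (hy : Even y) :
    quadraticChar (ZMod p) c = J(x | 5) := by
  have hx : Odd x := by
    by_contra hx
    rw [Nat.not_odd_iff_even] at hx
    have : Even p := by rw [h]; simp [hx, hy, Nat.even_add, Nat.even_pow]
    rw [Nat.even_iff] at this; omega
  have h0 : (x : ZMod p) ^ 2 + 5 * (y : ZMod p) ^ 2 = 0 := by
    have := congrArg (Nat.cast : ℕ → ZMod p) h
    push_cast at this
    rw [← this, ZMod.natCast_self]
  have hy0 : y ≠ 0 := by rintro rfl; exact ne_zero_of_prime_eq_sq_add h rfl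
  have hx8 : x ^ 2 % 8 = 1 := by
    have : x % 8 = 1 ∨ x % 8 = 3 ∨ x % 8 = 5 ∨ x % 8 = 7 := by
      obtain ⟨m, rfl⟩ := hx; omega
    rcases this with h1 | h1 | h1 | h1 <;> simp [Nat.pow_mod, h1]
  have h2 : quadraticChar (ZMod p) (y : ZMod p) = quadraticChar (ZMod p) 2 := by
    obtain ⟨k, z, hz, hk⟩ := Nat.exists_eq_two_pow_mul_odd hy0
    have hz1 : quadraticChar (ZMod p) (z : ZMod p) = 1 :=
      quadraticChar_odd_of_eq_sq_add_mul_sq (d := 5 * (2 ^ k) ^ 2) hp (by rw [h, hk]; ring) hz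
    rw [hk]; push_cast
    rw [map_mul, map_pow, hz1, mul_one]
    rcases k with _ | _ | k
    · rw [hk, pow_zero, one_mul] at hy
      exact absurd hz (Nat.not_odd_iff_even.mpr hy)
    · simp
    · have : p % 8 = 1 := by
        have : p = x ^ 2 + 8 * (10 * (2 ^ k * z) ^ 2) := by rw [h, hk]; ring
        omega
      rw [quadraticChar_two_mod_eight_eq_one this, one_pow]
  have h3 := quadraticChar_sqrt_five_mul hp hc h0
  have h4 := quadraticChar_sq_one (two_ne_zero_of_mod_four hp)
  rw [h2, quadraticChar_odd_of_dvd hp h hx dvd_rfl] at h3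
  linear_combination -h3 - quadraticChar (ZMod p) c * h4

/-- Here `x` is even. The minus sign comes from J(2 | 5) = -1 if 2 divides `x` exactly once (then
χ(2) = 1), and from χ(2) = -1 if 4 ∣ x. -/
theorem quadraticChar_sqrt_five_of_odd_right (hp : p % 4 = 1) (hp5 : p % 5 ≠ 0) {c : ZMod p} (hc : c ^ 2 = 5)
    {x y : ℕ} (h : p = x ^ 2 + 5 * y ^ 2) (hy : Odd y) :
    quadraticChar (ZMod p) c = -J(x | 5) := by
  have hx : Even x := by
    by_contra hx
    rw [Nat.not_even_iff_odd] at hx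
    have : Even p := by
      rw [h]; exact (hx.pow).add_odd ((by decide : Odd 5).mul hy.pow)
    rw [Nat.even_iff] at this; omega
  have h0 : (x : ZMod p) ^ 2 + 5 * (y : ZMod p) ^ 2 = 0 := by
    have := congrArg (Nat.cast : ℕ → ZMod p) h
    push_cast at this
    rw [← this, ZMod.natCast_self]
  have hx0 : x ≠ 0 := by
    rintro rfl
    have h5 : p = 5 * y ^ 2 := by rw [h]; ring
    omega
  have hy8 : y ^ 2 % 8 = 1 := by
    have : y % 8 = 1 ∨ y % 8 = 3 ∨ y % 8 = 5 ∨ y % 8 = 7 := by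
      obtain ⟨m, rfl⟩ := hy; omega
    rcases this with h1 | h1 | h1 | h1 <;> simp [Nat.pow_mod, h1]
  have h2 : quadraticChar (ZMod p) 2 * quadraticChar (ZMod p) (x : ZMod p) = -J(x | 5) := by
    obtain ⟨k, z, hz, hk⟩ := Nat.exists_eq_two_pow_mul_odd hx0
    have hz1 : quadraticChar (ZMod p) (z : ZMod p) = J(z | 5) :=
      quadraticChar_odd_of_dvd hp h hz ⟨2 ^ k, by rw [hk]; ring⟩
    have h25 : J(2 | 5) = -1 := jacobiSym_five_of_sq_mod_four (by norm_num)
    rw [hk]; push_cast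
    rw [map_mul, map_pow, hz1, jacobiSym.mul_left, jacobiSym.pow_left, h25]
    rcases k with _ | _ | k
    · rw [hk, pow_zero, one_mul] at hx
      exact absurd hz (Nat.not_odd_iff_even.mpr hx)
    · have : p % 8 = 1 := by
        have h1 : p = 4 * z ^ 2 + 5 * y ^ 2 := by rw [h, hk]; ring
        have h2 : z ^ 2 % 2 = 1 := Nat.odd_iff.mp hz.pow
        omega
      rw [quadraticChar_two_mod_eight_eq_one this]; ring
    · have : p % 8 = 5 := by
        have : p = 8 * (2 * (2 ^ k * z) ^ 2) + 5 * y ^ 2 := by rw [h, hk]; ring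
        omega
      rw [quadraticChar_two_mod_eight_eq_five this]; ring
  have h3 := quadraticChar_sqrt_five_mul hp hc h0
  have h4 := quadraticChar_sq_one (two_ne_zero_of_mod_four hp)
  rw [quadraticChar_odd_of_eq_sq_add_mul_sq hp h hy, mul_one] at h3
  linear_combination h2 - quadraticChar (ZMod p) 2 * h3 - quadraticChar (ZMod p) c * h4

/-! ### The fifth cyclotomic field and sums of two squares -/

/-- `-2 * (5 + √5)` is a square modulo `p` exactly when `p` splits in the fifth cyclotomic field. -/
theorem isSquare_neg_two_mul_five_add_sqrt_five_iff (hp : p % 4 = 1) (hp5 : p % 5 ≠ 0)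
    {c : ZMod p} (hc : c ^ 2 = 5) : IsSquare (-2 * (5 + c)) ↔ p % 5 = 1 := by
  have h2 := two_ne_zero_of_mod_four hp
  have h5 := five_ne_zero_of_mod_five hp5
  have hpp : p.Prime := Fact.out
  constructor
  · rintro ⟨w, hw⟩
    -- `z` solves z + 1/z = (c - 1)/2, whose discriminant involves (c - 1)² - 16 = -2(5 + c); it
    -- will be a primitive fifth root of unity.
    obtain ⟨z, hz⟩ : ∃ z : ZMod p, 4 * z = c - 1 + w := ⟨(c - 1 + w) / 4, by
      have : (4 : ZMod p) ≠ 0 := by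
        have := mul_ne_zero h2 h2; norm_num at this; exact this
      field_simp⟩
    have hq : 2 * z ^ 2 - (c - 1) * z + 2 = 0 := by
      have : (8 : ZMod p) * (2 * z ^ 2 - (c - 1) * z + 2) = 0 := by
        linear_combination (4 * z + (c - 1 + w) - 2 * (c - 1)) * hz - hw - hc
      have h8 : (8 : ZMod p) ≠ 0 := by
        have := pow_ne_zero 3 h2; norm_num at this; exact this
      exact (mul_eq_zero.mp this).resolve_left h8
    have hq4 : z ^ 4 + z ^ 3 + z ^ 2 + z + 1 = 0 := by
      have : (4 : ZMod p) * (z ^ 4 + z ^ 3 + z ^ 2 + z + 1) = 0 := by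
        -- Over 𝔽ₚ(√5), 4Φ₅ is the product of this quadratic and its conjugate under c ↦ -c.
        linear_combination (2 * z ^ 2 + (c + 1) * z + 2) * hq + z ^ 2 * hc
      have h4 : (4 : ZMod p) ≠ 0 := by
        have := mul_ne_zero h2 h2; norm_num at this; exact this
      exact (mul_eq_zero.mp this).resolve_left h4
    have hz5 : z ^ 5 = 1 := by linear_combination (z - 1) * hq4
    have hz1 : z ≠ 1 := by
      rintro rfl
      apply h5; linear_combination hq4
    have hz0 : z ≠ 0 := by rintro rfl; simp at hz5
    have : Fact (Nat.Prime 5) := ⟨Nat.prime_five⟩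
    have ho : orderOf z = 5 := orderOf_eq_prime hz5 hz1
    have hd : 5 ∣ p - 1 := ho ▸ orderOf_dvd_of_pow_eq_one (ZMod.pow_card_sub_one_eq_one hz0)
    have := hpp.one_lt
    omega
  · intro hp1
    have : Fact (Nat.Prime 5) := ⟨Nat.prime_five⟩
    have hd : 5 ∣ Fintype.card (ZMod p)ˣ := by
      rw [ZMod.card_units]; have := hpp.one_lt; omega
    obtain ⟨u, hu⟩ := exists_prime_orderOf_dvd_card 5 hd
    obtain ⟨z, hz⟩ : ∃ z : ZMod p, z = u := ⟨_, rfl⟩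
    have hz5 : z ^ 5 = 1 := by
      rw [hz, ← Units.val_pow_eq_pow_val, ← hu, pow_orderOf_eq_one, Units.val_one]
    have hz1 : z - 1 ≠ 0 := by
      rw [sub_ne_zero]; rintro rfl
      have : u = 1 := Units.ext hz.symm
      rw [this, orderOf_one] at hu; omega
    have hq4 : z ^ 4 + z ^ 3 + z ^ 2 + z + 1 = 0 := by
      have : (z - 1) * (z ^ 4 + z ^ 3 + z ^ 2 + z + 1) = 0 := by linear_combination hz5
      exact (mul_eq_zero.mp this).resolve_left hz1
    -- The quadratic Gauss sum is a square root of 5; the opposite sign of `c` amounts to replacing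
    -- `z` by z².
    have hcz : c ^ 2 = (2 * (z + z ^ 4) + 1) ^ 2 := by
      linear_combination hc - 4 * hq4 - (8 + 4 * z ^ 3) * hz5
    rcases sq_eq_sq_iff_eq_or_eq_neg.mp hcz with h | h
    · refine ⟨2 * (z - z ^ 4), ?_⟩
      rw [h]
      linear_combination -4 * hq4 + (8 - 4 * z ^ 3) * hz5
    · refine ⟨2 * (z ^ 2 - z ^ 3), ?_⟩
      rw [h]
      linear_combination (8 - 4 * z) * hz5

theorem quadraticChar_sqrt_five_mul_two_mul_one_add (hp : p % 4 = 1) (hp5 : p % 5 = 1 ∨ p % 5 = 4)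
    {c : ZMod p} (hc : c ^ 2 = 5) :
    quadraticChar (ZMod p) c * quadraticChar (ZMod p) (2 * (1 + c)) =
      if p % 5 = 1 then 1 else -1 := by
  have h2 := two_ne_zero_of_mod_four hp
  have h5 : (5 : ZMod p) ≠ 0 := five_ne_zero_of_mod_five (by omega)
  have h5c : -2 * (5 + c) ≠ 0 := by
    refine mul_ne_zero (neg_ne_zero.mpr h2) fun h => ?_
    apply mul_ne_zero (mul_ne_zero h2 h2) h5
    linear_combination hc - (c - 5) * h
  have h1 : c * (2 * (1 + c)) = -1 * (-2 * (5 + c)) := by linear_combination 2 * hc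
  rw [← map_mul, h1, map_mul, quadraticChar_neg_one_of_mod_four hp, one_mul]
  split_ifs with h
  · rw [quadraticChar_one_iff_isSquare h5c,
      isSquare_neg_two_mul_five_add_sqrt_five_iff hp (by omega) hc]
    exact h
  · rw [quadraticChar_neg_one_iff_not_isSquare,
      isSquare_neg_two_mul_five_add_sqrt_five_iff hp (by omega) hc]
    exact h

/-- Since 2a ≡ -b mod b + 2a, 4p ≡ 5b² there; reciprocity does the rest. -/
theorem quadraticChar_add_two_mul_of_eq_sq_add_sq (hp : p % 4 = 1) {a b : ℕ}
    (h : p = a ^ 2 + b ^ 2) (hb : Odd b) :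
    quadraticChar (ZMod p) ((b + 2 * a : ℕ) : ZMod p) = J((b + 2 * a : ℕ) | 5) := by
  have hn : Odd (b + 2 * a) := hb.add_even (even_two_mul a)
  have hab : Nat.Coprime a b := coprime_of_prime_eq_sq_add_mul_sq (p := p) (d := 1) (by rw [h, one_mul])
  have hcop : Nat.Coprime b (b + 2 * a) := by
    rw [Nat.coprime_self_add_right]
    exact (Nat.coprime_two_right.mpr hb).mul_right hab.symm
  rw [quadraticChar_natCast_eq_jacobiSym_of_odd hp hn]
  have h2 : IsCoprime (2 : ℤ) ((b + 2 * a : ℕ) : ℤ) := by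
    exact_mod_cast Nat.isCoprime_iff_coprime.mpr (Nat.coprime_two_left.mpr hn)
  rw [← jacobiSym_mul_sq h2]
  have : J((p : ℤ) * 2 ^ 2 | b + 2 * a) = J(5 * (b : ℤ) ^ 2 | b + 2 * a) := by
    apply jacobiSym.mod_left'
    rw [h]; push_cast
    have : ((a : ℤ) ^ 2 + b ^ 2) * 4 = 5 * (b : ℤ) ^ 2 + (b + 2 * a) * (2 * a - b) := by ring
    rw [this, Int.add_mul_emod_self_left]
  rw [this, jacobiSym_mul_sq (Nat.isCoprime_iff_coprime.mpr hcop)]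
  exact jacobiSym.quadratic_reciprocity_one_mod_four (a := 5) (by norm_num) hn

/-- With t = a/b a square root of -1, 2(1 + c)(1 + 2t) = (1 + c + 2t)², and b(1 + 2t) = b + 2a with
χ(b) = 1. -/
theorem quadraticChar_two_mul_one_add_sqrt_five (hp : p % 4 = 1) (hp5 : p % 5 ≠ 0)
    {c : ZMod p} (hc : c ^ 2 = 5) {a b : ℕ} (h : p = a ^ 2 + b ^ 2) (hb : Odd b) :
    quadraticChar (ZMod p) (2 * (1 + c)) = J((b + 2 * a : ℕ) | 5) := by
  have h2 := two_ne_zero_of_mod_four hp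
  have h5 := five_ne_zero_of_mod_five hp5
  have hb1 : quadraticChar (ZMod p) (b : ZMod p) = 1 :=
    quadraticChar_odd_of_eq_sq_add_mul_sq (d := 1) hp (by rw [h, one_mul]) hb
  have hb0 : (b : ZMod p) ≠ 0 := by
    intro h0; rw [h0] at hb1; simp at hb1
  have h0 : (a : ZMod p) ^ 2 + (b : ZMod p) ^ 2 = 0 := by
    have := congrArg (Nat.cast : ℕ → ZMod p) h
    push_cast at this
    rw [← this, ZMod.natCast_self]
  obtain ⟨t, ht⟩ : ∃ t : ZMod p, (a : ZMod p) = b * t := ⟨a / b, by field_simp⟩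
  have ht2 : t ^ 2 = -1 := by
    have : (b : ZMod p) ^ 2 * (t ^ 2 + 1) = 0 := by rw [ht] at h0; linear_combination h0
    linear_combination (mul_eq_zero.mp this).resolve_left (pow_ne_zero 2 hb0)
  rw [← quadraticChar_add_two_mul_of_eq_sq_add_sq hp h hb]
  have hfac : ((b + 2 * a : ℕ) : ZMod p) = b * (1 + 2 * t) := by
    push_cast; rw [ht]; ring
  rw [hfac, map_mul (quadraticChar (ZMod p)) (b : ZMod p), hb1, one_mul]
  refine quadraticChar_eq_of_mul_eq_sq (w := 1 + c + 2 * t) (mul_ne_zero h2 fun h1 => ?_)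
    (fun h1 => h5 ?_) (by linear_combination hc + 4 * ht2)
  · apply mul_ne_zero h2 h2
    linear_combination -hc + (c - 1) * h1
  · linear_combination (1 - 2 * t) * h1 + 4 * ht2

theorem quadraticChar_sqrt_five_eq_one_of_dvd (hp : p % 4 = 1) (hp5 : p % 5 = 1 ∨ p % 5 = 4)
    {c : ZMod p} (hc : c ^ 2 = 5) {a b : ℕ} (h : p = a ^ 2 + b ^ 2) (hb : Odd b) (ha : 5 ∣ a) :
    quadraticChar (ZMod p) c = 1 := by
  have h1 := quadraticChar_sqrt_five_mul_two_mul_one_add hp hp5 hc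
  rw [quadraticChar_two_mul_one_add_sqrt_five hp (by omega) hc h hb] at h1
  obtain ⟨k, rfl⟩ := ha
  have hsq : (((b + 2 * (5 * k) : ℕ) : ℤ) ^ 2) % 5 = p % 5 := by
    have : (((b + 2 * (5 * k) : ℕ) : ℤ) ^ 2) = p + 5 * (4 * b * k + 15 * k ^ 2) := by
      rw [h]; push_cast; ring
    rw [this, Int.add_mul_emod_self_left]
  rcases hp5 with h5 | h5
  · rw [jacobiSym_five_of_sq_mod_one (by omega), if_pos h5, mul_one] at h1
    exact h1
  · rw [jacobiSym_five_of_sq_mod_four (by omega), if_neg (by omega)] at h1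
    linarith

theorem quadraticChar_sqrt_five_eq_neg_one_of_dvd (hp : p % 4 = 1)
    (hp5 : p % 5 = 1 ∨ p % 5 = 4) {c : ZMod p} (hc : c ^ 2 = 5) {a b : ℕ}
    (h : p = a ^ 2 + b ^ 2) (hb : Odd b) (hb5 : 5 ∣ b) : quadraticChar (ZMod p) c = -1 := by
  have h1 := quadraticChar_sqrt_five_mul_two_mul_one_add hp hp5 hc
  rw [quadraticChar_two_mul_one_add_sqrt_five hp (by omega) hc h hb] at h1
  obtain ⟨k, rfl⟩ := hb5
  have hsq : (((5 * k + 2 * a : ℕ) : ℤ) ^ 2) % 5 = 4 * p % 5 := by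
    have : (((5 * k + 2 * a : ℕ) : ℤ) ^ 2) = 4 * p + 5 * (4 * k * a - 15 * k ^ 2) := by
      rw [h]; push_cast; ring
    rw [this, Int.add_mul_emod_self_left]
  rcases hp5 with h5 | h5
  · rw [jacobiSym_five_of_sq_mod_four (by omega), if_pos h5] at h1
    linarith
  · rw [jacobiSym_five_of_sq_mod_one (by omega), if_neg (by omega), mul_one] at h1
    exact h1

theorem isSquare_five (hp5 : p % 5 = 1 ∨ p % 5 = 4) : IsSquare (5 : ZMod p) := by
  have h2 : p ≠ 2 := by omega
  have : Fact (Nat.Prime 5) := ⟨Nat.prime_five⟩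
  have := ZMod.exists_sq_eq_prime_iff_of_mod_four_eq_one (p := 5) (q := p) (by norm_num) h2
  rw [Nat.cast_ofNat] at this
  rw [← this, ← ZMod.natCast_mod]
  rcases hp5 with h | h <;> rw [h]
  · exact ⟨1, rfl⟩
  · exact ⟨2, rfl⟩

/-- `p` is represented by `x² + 100 * y²` exactly when `√5` is a square modulo `p`. -/
theorem exists_sq_add_hundred_mul_sq_iff (hp : p % 4 = 1) (hp5 : p % 5 = 1 ∨ p % 5 = 4)
    {c : ZMod p} (hc : c ^ 2 = 5) :
    (∃ x y : ℤ, (p : ℤ) = x ^ 2 + 100 * y ^ 2) ↔ quadraticChar (ZMod p) c = 1 := by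
  constructor
  · rintro ⟨x, y, h⟩
    have h' : p = (10 * y.natAbs) ^ 2 + x.natAbs ^ 2 := by
      zify; rw [mul_pow, sq_abs, sq_abs, h]; ring
    refine quadraticChar_sqrt_five_eq_one_of_dvd hp hp5 hc h' ?_ ⟨2 * y.natAbs, by ring⟩
    by_contra hx
    obtain ⟨k, hk⟩ := even_iff_two_dvd.mp (Nat.not_odd_iff_even.mp hx)
    have : p = 2 * (50 * y.natAbs ^ 2 + 2 * k ^ 2) := by rw [h', hk]; ring
    omega
  · intro hχ
    obtain ⟨a, b, h, hb⟩ : ∃ a b : ℕ, p = a ^ 2 + b ^ 2 ∧ Odd b := by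
      obtain ⟨a, b, h⟩ := Nat.Prime.sq_add_sq (p := p) (by omega)
      rcases Nat.even_or_odd b with hb | hb
      · refine ⟨b, a, by rw [← h, add_comm], ?_⟩
        by_contra ha
        have : Even p := by
          rw [← h]; simp [Nat.not_odd_iff_even.mp ha, hb, Nat.even_add, Nat.even_pow]
        rw [Nat.even_iff] at this; omega
      · exact ⟨a, b, h.symm, hb⟩
    have ha2 : 2 ∣ a := by
      rw [← even_iff_two_dvd]
      by_contra ha
      have : Even p := by rw [h]; exact (Nat.not_even_iff_odd.mp ha).pow.add_odd hb.pow
      rw [Nat.even_iff] at this; omega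
    by_cases ha5 : 5 ∣ a
    · obtain ⟨k, rfl⟩ : 10 ∣ a := by omega
      exact ⟨b, k, by rw [h]; push_cast; ring⟩
    -- Two nonzero squares mod 5 sum to 0 or ±2, never ±1.
    · have hb5 : 5 ∣ b := by
        by_contra hb5
        have h5 : (a ^ 2 + b ^ 2) % 5 = 1 ∨ (a ^ 2 + b ^ 2) % 5 = 4 := by rw [← h]; exact hp5
        have ha' : a % 5 = 1 ∨ a % 5 = 2 ∨ a % 5 = 3 ∨ a % 5 = 4 := by omega
        have hb' : b % 5 = 1 ∨ b % 5 = 2 ∨ b % 5 = 3 ∨ b % 5 = 4 := by omega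
        rcases ha' with ha' | ha' | ha' | ha' <;> rcases hb' with hb' | hb' | hb' | hb' <;>
          simp [Nat.add_mod, Nat.pow_mod, ha', hb'] at h5
      rw [quadraticChar_sqrt_five_eq_neg_one_of_dvd hp hp5 hc h hb hb5] at hχ
      norm_num at hχ

/-! ### Thue's lemma and the form x² + 5y² -/

/-- Dirichlet approximation of s/p with denominator at most ⌊√p⌋. -/
theorem exists_sq_lt_and_dvd_mul_sub (s : ℤ) :
    ∃ x y : ℤ, 0 < y ∧ x ^ 2 < p ∧ y ^ 2 < p ∧ (p : ℤ) ∣ s * y - x := by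
  have hp : p.Prime := Fact.out
  have hp0 : (0 : ℝ) < p := by exact_mod_cast hp.pos
  have hn : 0 < Nat.sqrt p := Nat.sqrt_pos.mpr hp.pos
  obtain ⟨j, k, hk0, hkn, hjk⟩ := Real.exists_int_int_abs_mul_sub_le (s / p : ℝ) hn
  refine ⟨s * k - p * j, k, hk0, ?_, ?_, ⟨j, by ring⟩⟩
  · have h1 : |((s * k - p * j : ℤ) : ℝ)| ≤ p / (Nat.sqrt p + 1) := by
      have : ((s * k - p * j : ℤ) : ℝ) = p * (k * (s / p) - j) := by
        push_cast; field_simp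
      rw [this, abs_mul, abs_of_pos hp0, div_eq_mul_one_div (p : ℝ) ((Nat.sqrt p : ℝ) + 1)]
      exact mul_le_mul_of_nonneg_left hjk hp0.le
    have h2 : (p : ℝ) < (Nat.sqrt p + 1) ^ 2 := by
      have := Nat.lt_succ_sqrt' p
      exact_mod_cast this
    have h3 : (((s * k - p * j : ℤ) : ℝ)) ^ 2 < p := by
      rw [← sq_abs]
      calc _ ≤ ((p : ℝ) / (Nat.sqrt p + 1)) ^ 2 := by gcongr
        _ = p * (p / (Nat.sqrt p + 1) ^ 2) := by rw [div_pow]; ring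
        _ < p * 1 := by
          gcongr
          rwa [div_lt_one (by positivity)]
        _ = p := mul_one _
    exact_mod_cast h3
  · have h1 : k ^ 2 ≤ (Nat.sqrt p : ℤ) ^ 2 := by gcongr
    have h2 : (Nat.sqrt p : ℤ) ^ 2 ≤ p := by exact_mod_cast Nat.sqrt_le' p
    refine lt_of_le_of_ne (h1.trans h2) fun h => ?_
    exact (Nat.prime_iff_prime_int.mp hp).not_isSquare ⟨k, by rw [← h]; ring⟩

theorem exists_eq_sq_add_five_mul_sq (hp : p % 4 = 1) (hp5 : p % 5 = 1 ∨ p % 5 = 4) :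
    ∃ x y : ℕ, p = x ^ 2 + 5 * y ^ 2 := by
  suffices ∃ x y : ℤ, (p : ℤ) = x ^ 2 + 5 * y ^ 2 by
    obtain ⟨x, y, h⟩ := this
    exact ⟨x.natAbs, y.natAbs, by zify; rw [sq_abs, sq_abs, h]⟩
  obtain ⟨s, hs⟩ : ∃ s : ℤ, (p : ℤ) ∣ s ^ 2 + 5 := by
    obtain ⟨c, hc⟩ := isSquare_five hp5
    obtain ⟨i, hi⟩ : IsSquare (-1 : ZMod p) := ZMod.exists_sq_eq_neg_one_iff.mpr (by omega)
    obtain ⟨s, hs⟩ := ZMod.intCast_surjective (c * i)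
    refine ⟨s, (ZMod.intCast_zmod_eq_zero_iff_dvd _ _).mp ?_⟩
    push_cast
    rw [hs]
    linear_combination -i ^ 2 * hc - 5 * hi
  obtain ⟨x, y, hy0, hx, hy, hd⟩ := exists_sq_lt_and_dvd_mul_sub (p := p) s
  obtain ⟨k, hk⟩ : (p : ℤ) ∣ x ^ 2 + 5 * y ^ 2 := by
    have : x ^ 2 + 5 * y ^ 2 = y ^ 2 * (s ^ 2 + 5) - (s * y - x) * (s * y + x) := by ring
    rw [this]
    exact dvd_sub (hs.mul_left _) (hd.mul_right _)
  have hp0 : (0 : ℤ) < p := by exact_mod_cast (Fact.out : p.Prime).pos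
  have hk0 : 0 < k := by
    by_contra! h
    nlinarith [sq_nonneg x, pow_pos hy0 2]
  have hk6 : k < 6 := by
    by_contra! h
    nlinarith
  have hx5 : x ^ 2 % 5 = 0 ∨ x ^ 2 % 5 = 1 ∨ x ^ 2 % 5 = 4 := by
    have : x % 5 = 0 ∨ x % 5 = 1 ∨ x % 5 = 2 ∨ x % 5 = 3 ∨ x % 5 = 4 := by omega
    rcases this with h | h | h | h | h <;> simp [pow_two, Int.mul_emod, h]
  -- k = 2, 3 fail because ±2 is not a square mod 5; k = 4 forces `x`, `y` even; k = 5 forces 5 ∣ x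
  -- and swaps the coordinates.
  interval_cases k
  · exact ⟨x, y, by linarith⟩
  · omega
  · omega
  · have hxy : 2 ∣ x ∧ 2 ∣ y := by
      have hx4 : x % 2 = 0 ∧ x ^ 2 % 4 = 0 ∨ x % 2 = 1 ∧ x ^ 2 % 4 = 1 := by
        have : x % 4 = 0 ∨ x % 4 = 1 ∨ x % 4 = 2 ∨ x % 4 = 3 := by omega
        rcases this with h | h | h | h <;> simp [pow_two, Int.mul_emod, h] <;> omega
      have hy4 : y % 2 = 0 ∧ y ^ 2 % 4 = 0 ∨ y % 2 = 1 ∧ y ^ 2 % 4 = 1 := by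
        have : y % 4 = 0 ∨ y % 4 = 1 ∨ y % 4 = 2 ∨ y % 4 = 3 := by omega
        rcases this with h | h | h | h <;> simp [pow_two, Int.mul_emod, h] <;> omega
      omega
    obtain ⟨⟨u, rfl⟩, ⟨v, rfl⟩⟩ := hxy
    exact ⟨u, v, by linarith⟩
  · obtain ⟨u, rfl⟩ : (5 : ℤ) ∣ x :=
      Int.Prime.dvd_pow' (k := 2) Nat.prime_five (by push_cast; omega)
    exact ⟨y, u, by linarith⟩

theorem exists_sq_add_twenty_mul_sq_iff (hp : p % 4 = 1) (hp5 : p % 5 = 1 ∨ p % 5 = 4)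
    {c : ZMod p} (hc : c ^ 2 = 5) :
    (∃ x y : ℤ, (p : ℤ) = x ^ 2 + 20 * y ^ 2) ↔
      quadraticChar (ZMod p) c = if p % 5 = 1 then 1 else -1 := by
  have key {x y : ℕ} (h : p = x ^ 2 + 5 * y ^ 2) : J(x | 5) = if p % 5 = 1 then 1 else -1 := by
    have hsq : (x : ℤ) ^ 2 % 5 = p % 5 := by
      rw [h]; push_cast; rw [Int.add_mul_emod_self_left]
    split_ifs with h5
    · exact jacobiSym_five_of_sq_mod_one (by omega)
    · exact jacobiSym_five_of_sq_mod_four (by omega)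
  constructor
  · rintro ⟨x, y, h⟩
    have h' : p = x.natAbs ^ 2 + 5 * (2 * y.natAbs) ^ 2 := by
      zify; rw [mul_pow, sq_abs, sq_abs, h]; ring
    rw [quadraticChar_sqrt_five_of_even_right hp hc h' (even_two_mul _), key h']
  · intro hχ
    obtain ⟨x, y, h⟩ := exists_eq_sq_add_five_mul_sq hp hp5
    rcases Nat.even_or_odd y with hy | hy
    · obtain ⟨k, rfl⟩ := even_iff_two_dvd.mp hy
      exact ⟨x, k, by rw [h]; push_cast; ring⟩
    · rw [quadraticChar_sqrt_five_of_odd_right hp (by omega) hc h hy, key h] at hχ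
      split_ifs at hχ <;> norm_num at hχ

end

theorem mainTheorem8 (p : ℕ) (hp : Nat.Prime p) :
    (p ≡ 1 [MOD 20] →
      ((∃ x y : ℤ, (p : ℤ) = x ^ 2 + 20 * y ^ 2) ↔
        (∃ x y : ℤ, (p : ℤ) = x ^ 2 + 100 * y ^ 2))) ∧
    (p ≡ 9 [MOD 20] →
      Xor (∃ x y : ℤ, (p : ℤ) = x ^ 2 + 20 * y ^ 2)
        (∃ x y : ℤ, (p : ℤ) = x ^ 2 + 100 * y ^ 2)) := by
  have : Fact p.Prime := ⟨hp⟩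
  constructor
  · intro h
    have hm : p % 20 = 1 := h
    obtain ⟨c, hc⟩ := isSquare_five (p := p) (by omega)
    have hc2 : c ^ 2 = 5 := by rw [hc, pow_two]
    rw [exists_sq_add_twenty_mul_sq_iff (by omega) (by omega) hc2,
      exists_sq_add_hundred_mul_sq_iff (by omega) (by omega) hc2, if_pos (by omega)]
  · intro h
    have hm : p % 20 = 9 := h
    obtain ⟨c, hc⟩ := isSquare_five (p := p) (by omega)
    have hc2 : c ^ 2 = 5 := by rw [hc, pow_two]
    have hc0 : c ≠ 0 := by
      rintro rfl
      exact five_ne_zero_of_mod_five (p := p) (by omega) (by rw [hc, mul_zero])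
    rw [exists_sq_add_twenty_mul_sq_iff (by omega) (by omega) hc2,
      exists_sq_add_hundred_mul_sq_iff (by omega) (by omega) hc2, if_neg (by omega)]
    rcases quadraticChar_dichotomy hc0 with h1 | h1 <;> rw [h1]
    · exact Or.inr ⟨rfl, by norm_num⟩
    · exact Or.inl ⟨rfl, by norm_num⟩
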